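/- Consider non-atomic congestion games on parallel networks: finitely many parallel edges $e$ join one origin to one destination, edge $e$ has latency $\ell_e(f)=a_ef+b_e$ with $a_e,b_e\ge 0$, and the users form a closed interval $N$ whose Lebesgue measure is the mass of traffic. Let $\mathcal G^{\rm pa}$ be the class of all such games in which every edge has positive traffic in an untolled Nash flow. Let $0<S_L\le S_U$ be normalized so that $S_LS_U=1$, and let $\mathcal S$ be the set of sensitivity distributions $s:N\to[S_L,S_U]$. An affine mechanism $T$ assigns to every edge with latency $af+b$ the incentive $\tau(f)=k_1af+k_2b$, with constants $k_1,k_2$ that do not depend on the edge or on the game. User $x$ on edge $e$ has cost $\ell_e(f_e)+s_x\tau_e(f_e)$, and a flow is a Nash flow if it is induced by a choice of edges in which every user is on an edge of least cost to that user. With $\mathcal L(f)=\sum_e f_e\ell_e(f_e)$, let $$\mathrm{PoA}(T)=\sup_{G\in\mathcal G^{\rm pa}}\ \sup_{s\in\mathcal S}\ \frac{\max\{\mathcal L(f): f\text{ is a Nash flow of }(G,s,T)\}}{\min\{\mathcal L(f): f\text{ is a feasible flow of }G\}}.$$ For $\beta>0$, a toll with bound $\beta$ is an affine mechanism with $0\le\tau(f)\le\beta\ell(f)$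 for all $f\ge 0$ on every edge, and a subsidy with bound $\beta$ is an affine mechanism with $-\beta\ell(f)\le\tau(f)\le 0$ for all $f\ge 0$ on every edge. Then for every $\beta>0$ there are a toll $T^{\rm opt+}(\beta)$ and a subsidy $T^{\rm opt-}(\beta)$ that minimize $\mathrm{PoA}$ among the tolls, respectively among the subsidies, with bound $\beta$; and with $\beta^*=1/S_U=S_L$, any such minimizers satisfy: 1. if $\beta=\beta^*$, then $\mathrm{PoA}(T^{\rm opt-}(\beta))=\mathrm{PoA}(T^{\rm opt+}(\beta))$; 2. if $0<\beta<\beta^*$, then $\mathrm{PoA}(T^{\rm opt-}(\beta))<\mathrm{PoA}(T^{\rm opt+}(\beta))$; 3. if $\beta>\beta^*$, then $\mathrm{PoA}(T^{\rm opt+}(\beta))\le\mathrm{PoA}(T^{\rm opt-}(\beta))$, with strict inequality if $S_L<S_U$. -/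

import Mathlib

open MeasureTheory
open scoped ENNReal NNReal

/-- An affine latency function `f ↦ a f + b` with `a, b ≥ 0`. -/
structure AffineLatency where
  a : ℝ≥0
  b : ℝ≥0

/-- The latency observed on an edge carrying a mass `f` of traffic. -/
noncomputable def AffineLatency.eval (l : AffineLatency) (f : ℝ) : ℝ :=
  l.a * f + l.b

/-- A routing problem on a parallel network: one origin, one destination, `n` parallel edges
between them with affine latencies, and a mass `demand` of traffic. A path is a single edge. -/
structure ParallelGame where
  n : ℕ
  latency : Fin n → AffineLatency
  demand : ℝ≥0

/-- A network-agnostic incentive mechanism: it assigns to every edge an incentive function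
`f ↦ τ(f)` that depends on the latency function of the edge only. -/
abbrev Mechanism : Type := AffineLatency → ℝ → ℝ

namespace ParallelGame

/-- A flow is described by the mass of traffic on every edge. -/
abbrev Flow (G : ParallelGame) : Type := Fin G.n → ℝ

/-- The feasible flows: nonnegative, and routing the whole demand. -/
def feasible (G : ParallelGame) : Set G.Flow :=
  {f | (∀ e, 0 ≤ f e) ∧ ∑ e, f e = G.demand}

/-- The total latency `∑ f_e ℓ_e(f_e)` of a flow. -/
noncomputable def totalLatency (G : ParallelGame) (f : G.Flow) : ℝ :=
  ∑ e, f e * (G.latency e).eval (f e)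

/-- The total latency of an optimal flow. -/
noncomputable def optLatency (G : ParallelGame) : ℝ≥0∞ :=
  ⨅ f ∈ G.feasible, ENNReal.ofReal (G.totalLatency f)

/-- The non-atomic users: a closed interval whose Lebesgue measure is the demand. -/
abbrev Users (G : ParallelGame) : Type := Set.Icc (0 : ℝ) (G.demand : ℝ)

/-- The cost on edge `e`, in the flow `f` and under the mechanism `T`, of a user whose
sensitivity to incentives is `σ`. -/
noncomputable def cost (G : ParallelGame) (T : Mechanism) (f : G.Flow) (σ : ℝ)
    (e : Fin G.n) : ℝ :=
  (G.latency e).eval (f e) + σ * T (G.latency e) (f e)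

/-- `f` is a Nash flow for the sensitivity distribution `s` and the mechanism `T`: it is induced
by a (measurable) choice of an edge by every user such that no user has a cheaper edge. -/
def IsNash (G : ParallelGame) (s : G.Users → ℝ) (T : Mechanism) (f : G.Flow) : Prop :=
  ∃ P : G.Users → Fin G.n, Measurable P ∧
    (∀ e, f e = (volume : Measure ℝ).real (Subtype.val '' {x : G.Users | P x = e})) ∧
    ∀ x e, G.cost T f (s x) (P x) ≤ G.cost T f (s x) e

/-- The highest total latency of a Nash flow. -/
noncomputable def nashLatency (G : ParallelGame) (s : G.Users → ℝ) (T : Mechanism) : ℝ≥0∞ :=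
  ⨆ f : G.Flow, ⨆ _ : G.IsNash s T f, ENNReal.ofReal (G.totalLatency f)

/-- Every edge has positive traffic in an untolled Nash flow. -/
def FullyUtilized (G : ParallelGame) : Prop :=
  ∃ f : G.Flow, G.IsNash (fun _ => 1) (fun _ _ => 0) f ∧ ∀ e, 0 < f e

end ParallelGame

/-- The heterogeneous price of anarchy of a mechanism over all fully utilized parallel affine
congestion games and all sensitivity distributions with values in `[SL, SU]`. -/
noncomputable def priceOfAnarchy (SL SU : ℝ) (T : Mechanism) : ℝ≥0∞ :=
  ⨆ G : ParallelGame, ⨆ _ : G.FullyUtilized,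
    ⨆ s : G.Users → ℝ, ⨆ _ : ∀ x, s x ∈ Set.Icc SL SU,
      G.nashLatency s T / G.optLatency

/-- The affine mechanism that assigns `k₁ a f + k₂ b` to an edge with latency `a f + b`. -/
noncomputable def affineMechanism (k₁ k₂ : ℝ) : Mechanism :=
  fun l f => k₁ * (l.a * f) + k₂ * l.b

/-- The affine tolling mechanisms with incentive bound `β`: tolls lie in `[0, β ℓ(f)]`. -/
def affineTolls (β : ℝ) : Set Mechanism :=
  {T | (∃ k₁ k₂, T = affineMechanism k₁ k₂) ∧
    ∀ (l : AffineLatency) (f : ℝ), 0 ≤ f → T l f ∈ Set.Icc 0 (β * l.eval f)}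

/-- The affine subsidy mechanisms with incentive bound `β`: subsidies lie in `[-β ℓ(f), 0]`. -/
def affineSubsidies (β : ℝ) : Set Mechanism :=
  {T | (∃ k₁ k₂, T = affineMechanism k₁ k₂) ∧
    ∀ (l : AffineLatency) (f : ℝ), 0 ≤ f → T l f ∈ Set.Icc (-(β * l.eval f)) 0}

/-- `T` minimizes the heterogeneous price of anarchy over the set `M` of mechanisms. -/
def IsOptimalMechanism (SL SU : ℝ) (M : Set Mechanism) (T : Mechanism) : Prop :=
  T ∈ M ∧ ∀ T' ∈ M, priceOfAnarchy SL SU T ≤ priceOfAnarchy SL SU T'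

/-!
Under the mechanism `k₁ a f + k₂ b` a user of sensitivity `σ` ranks the edges by `a f + ρ b`, where
`ρ = (1 + σ k₂) / (1 + σ k₁)`. The socially optimal weight is `ρ = 1 / 2`, for which users compare
marginal total latencies. If all weights satisfy `|2 ρ - 1| ≤ E < 1`, then a Nash flow `f`, any
feasible flow `g` and the untolled Nash flow `h` satisfy `L(f) ≤ (1 - E²) L(g) + E² L(h)`, so that
the classical bound `L(h) ≤ (4 / 3) L(g)` gives the price of anarchy at most `1 + E² / 3`, and
Pigou's network shows that this is sharp.

Tolls and subsidies with bound `β` are the mechanisms with `k₁` and `k₂` in `[0, β]` and `[-β, 0]`.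
For coefficients in `[lo, hi]` there are two obstructions to a small `E`: the weight of the least
sensitive users is at least its value at `k₁ = hi`, `k₂ = lo`, and the weights of the
sensitivities `S_L` and `S_U` cannot both be near `1 / 2`, which is least severe at `k₁ = hi`. The
least distortion is the larger of the two, and it is attained by `k₁ = hi` and a suitable `k₂`.
For tolls the first obstruction decreases in `β` and meets the second obstruction for subsidies at
`β = 1 / S_U`.
-/

section QuadraticForms

variable {ι : Type*} [Fintype ι]

theorem sum_sum_mul_mul_sub_sq (w u : ι → ℝ) :
    ∑ i, ∑ j, w i * w j * (u i - u j) ^ 2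
      = 2 * ((∑ i, w i) * (∑ i, w i * u i ^ 2) - (∑ i, w i * u i) ^ 2) := by
  have expand (i j : ι) : w i * w j * (u i - u j) ^ 2
      = w i * u i ^ 2 * w j + w i * (w j * u j ^ 2) - 2 * ((w i * u i) * (w j * u j)) := by ring
  simp only [expand, Finset.sum_add_distrib, Finset.sum_sub_distrib, ← Finset.mul_sum,
    ← Finset.sum_mul]
  ring

variable {a x y z : ι → ℝ} {E : ℝ}

theorem sum_inv_mul_sum_mul_sq_sub_sq (ha : ∀ i, a i ≠ 0) (x : ι → ℝ) :
    (∑ i, (a i)⁻¹) * (∑ i, a i * x i ^ 2) - (∑ i, x i) ^ 2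
      = (∑ i, ∑ j, (a i)⁻¹ * (a j)⁻¹ * (a i * x i - a j * x j) ^ 2) / 2 := by
  have cancel_sq (i : ι) : (a i)⁻¹ * (a i * x i) ^ 2 = a i * x i ^ 2 := by
    rw [mul_pow, sq (a i), mul_assoc (a i), inv_mul_cancel_left₀ (ha i)]
  rw [sum_sum_mul_mul_sub_sq (fun i => (a i)⁻¹) fun i => a i * x i]
  simp only [cancel_sq, inv_mul_cancel_left₀ (ha _)]
  ring

theorem sum_mul_sq_le_of_lipschitz_of_pos (ha : ∀ i, 0 < a i) (hE : E ^ 2 ≤ 1)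
    (hx : ∑ i, x i = ∑ i, y i) (hz : ∑ i, z i = ∑ i, y i)
    (hlip : ∀ i j, (a i * x i - a j * x j) ^ 2 ≤ E ^ 2 * (a i * z i - a j * z j) ^ 2) :
    ∑ i, a i * x i ^ 2 ≤ (1 - E ^ 2) * ∑ i, a i * y i ^ 2 + E ^ 2 * ∑ i, a i * z i ^ 2 := by
  rcases isEmpty_or_nonempty ι with _ | _
  · simp
  have ha' (i : ι) : a i ≠ 0 := (ha i).ne'
  have hW : 0 < ∑ i, (a i)⁻¹ :=
    Finset.sum_pos (fun i _ => inv_pos.2 (ha i)) Finset.univ_nonempty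
  have cauchy_schwarz : (∑ i, y i) ^ 2 ≤ (∑ i, (a i)⁻¹) * ∑ i, a i * y i ^ 2 :=
    Finset.sum_sq_le_sum_mul_sum_of_sq_le_mul _ (fun i _ => (inv_pos.2 (ha i)).le)
      (fun i _ => mul_nonneg (ha i).le (sq_nonneg _))
      fun i _ => (inv_mul_cancel_left₀ (ha' i) _).ge
  have contraction : (∑ i, (a i)⁻¹) * (∑ i, a i * x i ^ 2) - (∑ i, x i) ^ 2
      ≤ E ^ 2 * ((∑ i, (a i)⁻¹) * (∑ i, a i * z i ^ 2) - (∑ i, z i) ^ 2) := by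
    rw [sum_inv_mul_sum_mul_sq_sub_sq ha', sum_inv_mul_sum_mul_sq_sub_sq ha', ← mul_div_assoc]
    simp only [Finset.mul_sum]
    gcongr (∑ i, ∑ j, ?_) / 2 with i _ j _
    rw [mul_left_comm]
    exact mul_le_mul_of_nonneg_left (hlip i j)
      (mul_pos (inv_pos.2 (ha i)) (inv_pos.2 (ha j))).le
  rw [hx, hz] at contraction
  refine le_of_mul_le_mul_left ?_ hW
  linarith [mul_le_mul_of_nonneg_left cauchy_schwarz (sub_nonneg.2 hE)]

theorem sum_mul_sq_le_of_lipschitz_of_eq_zero (ha : ∀ i, 0 ≤ a i) {k : ι} (hk : a k = 0)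
    (hlip : ∀ i j, (a i * x i - a j * x j) ^ 2 ≤ E ^ 2 * (a i * z i - a j * z j) ^ 2) :
    ∑ i, a i * x i ^ 2 ≤ E ^ 2 * ∑ i, a i * z i ^ 2 := by
  rw [Finset.mul_sum]
  refine Finset.sum_le_sum fun i _ => ?_
  rcases (ha i).eq_or_lt with hi | hi
  · simp [← hi]
  · have := hlip i k
    simp only [hk, zero_mul, sub_zero] at this
    refine le_of_mul_le_mul_left ?_ hi
    linarith

theorem sum_mul_sq_le_of_lipschitz (ha : ∀ i, 0 ≤ a i) (hE : E ^ 2 ≤ 1)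
    (hx : ∑ i, x i = ∑ i, y i) (hz : ∑ i, z i = ∑ i, y i)
    (hlip : ∀ i j, |a i * x i - a j * x j| ≤ E * |a i * z i - a j * z j|) :
    ∑ i, a i * x i ^ 2 ≤ (1 - E ^ 2) * ∑ i, a i * y i ^ 2 + E ^ 2 * ∑ i, a i * z i ^ 2 := by
  have hlip_sq (i j : ι) : (a i * x i - a j * x j) ^ 2 ≤ E ^ 2 * (a i * z i - a j * z j) ^ 2 := by
    simpa only [mul_pow, sq_abs] using pow_le_pow_left₀ (abs_nonneg _) (hlip i j) 2
  by_cases hzero : ∃ k, a k = 0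
  · obtain ⟨k, hk⟩ := hzero
    refine (sum_mul_sq_le_of_lipschitz_of_eq_zero ha hk hlip_sq).trans
      (le_add_of_nonneg_left (mul_nonneg (sub_nonneg.2 hE) ?_))
    exact Finset.sum_nonneg fun i _ => mul_nonneg (ha i) (sq_nonneg _)
  · push Not at hzero
    exact sum_mul_sq_le_of_lipschitz_of_pos (fun i => (ha i).lt_of_ne' (hzero i)) hE hx hz hlip_sq

end QuadraticForms

namespace ParallelGame

variable {G : ParallelGame} {f g h : G.Flow} {E Λ : ℝ}

section Equilibrium

/-- The cost that edge `e` has in the flow `f` for a user who counts the constant part of every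
latency with weight `r`. The untolled latency is the case `r = 1`, half the marginal total latency
the case `r = 1 / 2`. -/
noncomputable def weightedCost (G : ParallelGame) (f : G.Flow) (r : ℝ) (e : Fin G.n) : ℝ :=
  (G.latency e).a * f e + r * (G.latency e).b

/-- Edge `e` is a best response, in the flow `f`, of a user who counts the constant part of every
latency with weight `r`. -/
def IsCheapest (G : ParallelGame) (f : G.Flow) (r : ℝ) (e : Fin G.n) : Prop :=
  ∀ e', G.weightedCost f r e ≤ G.weightedCost f r e'

/-- `f` is a feasible flow whose users count the constant parts of the latencies with weights in
`[(1 - E) / 2, (1 + E) / 2]`, and use cheapest edges only. The distortion `E` measures how far the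
weights may be from the socially optimal `1 / 2`. -/
structure IsDistortedEquilibrium (G : ParallelGame) (E : ℝ) (f : G.Flow) : Prop where
  feasible : f ∈ G.feasible
  exists_isCheapest : ∀ e, 0 < f e → ∃ r : ℝ, |2 * r - 1| ≤ E ∧ G.IsCheapest f r e

theorem IsCheapest.sub_le {r : ℝ} {i j : Fin G.n} (hr : |2 * r - 1| ≤ E)
    (hi : G.IsCheapest f r i) :
    (2 * (G.latency i).a * f i + (G.latency i).b) - (2 * (G.latency j).a * f j + (G.latency j).b)
      ≤ E * |((G.latency i).b : ℝ) - (G.latency j).b| := by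
  have hij := hi j
  unfold weightedCost at hij
  calc
    _ ≤ -((2 * r - 1) * ((G.latency i).b - (G.latency j).b)) := by linarith
    _ ≤ |2 * r - 1| * |((G.latency i).b : ℝ) - (G.latency j).b| := by
      rw [← abs_mul]
      exact neg_le_abs _
    _ ≤ E * |((G.latency i).b : ℝ) - (G.latency j).b| := by gcongr

/-- If edge `j` were unused at `f`, then some other edge `i` would carry more traffic at `f` than at
`h`, and its users would prefer `j`, unless both latencies are constant. -/
theorem exists_constant_used_of_unused (hh : ∀ e, 0 < h e)
    (hΛ : ∀ e, (G.latency e).eval (h e) = Λ) (hsum : ∑ e, f e = ∑ e, h e)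
    (hf : ∀ e, 0 < f e → ∃ r : ℝ, 0 < r ∧ r ≤ 1 ∧ G.IsCheapest f r e)
    {j : Fin G.n} (hj : f j = 0) :
    (G.latency j).a = 0 ∧ ∃ i, 0 < f i ∧ (G.latency i).a = 0 := by
  obtain ⟨i, hi⟩ : ∃ i, h i < f i := by
    by_contra! hle
    exact (Finset.sum_lt_sum (fun e _ => hle e) ⟨j, Finset.mem_univ j, hj ▸ hh j⟩).ne hsum
  have hfi : 0 < f i := (hh i).trans hi
  obtain ⟨r, hr0, hr1, hr⟩ := hf i hfi
  have hij : (G.latency i).a * f i ≤ r * ((G.latency j).b - (G.latency i).b) := by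
    have := hr j
    simp only [weightedCost, hj, mul_zero, zero_add] at this
    linarith
  have hbij : (0 : ℝ) ≤ (G.latency j).b - (G.latency i).b :=
    nonneg_of_mul_nonneg_right ((mul_nonneg (NNReal.coe_nonneg _) hfi.le).trans hij) hr0
  have hineq : (G.latency i).a * (f i - h i) + (G.latency j).a * h j ≤ 0 := by
    have hΛi := hΛ i
    have hΛj := hΛ j
    unfold AffineLatency.eval at hΛi hΛj
    linarith [mul_le_of_le_one_left hbij hr1]
  have hi_nonneg : 0 ≤ (G.latency i).a * (f i - h i) :=
    mul_nonneg (NNReal.coe_nonneg _) (sub_nonneg.2 hi.le)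
  have hj_nonneg : 0 ≤ (G.latency j).a * h j := mul_nonneg (NNReal.coe_nonneg _) (hh j).le
  have hj_zero : (G.latency j).a * h j = 0 := by linarith
  have hi_zero : (G.latency i).a * (f i - h i) = 0 := by linarith
  simp only [mul_eq_zero, (hh j).ne', (sub_pos.2 hi).ne', or_false, NNReal.coe_eq_zero]
    at hj_zero hi_zero
  exact ⟨hj_zero, i, hfi, hi_zero⟩

theorem IsDistortedEquilibrium.exists_isCheapest_of_equalized
    (hf : G.IsDistortedEquilibrium E f) (hE : E < 1) (hh : ∀ e, 0 < h e)
    (hΛ : ∀ e, (G.latency e).eval (h e) = Λ) (hd : ∑ e, h e = G.demand) (e : Fin G.n) :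
    ∃ r : ℝ, |2 * r - 1| ≤ E ∧ G.IsCheapest f r e := by
  rcases (hf.feasible.1 e).eq_or_lt with he | he
  · have hweights (i : Fin G.n) (hi : 0 < f i) :
        ∃ r : ℝ, 0 < r ∧ r ≤ 1 ∧ G.IsCheapest f r i := by
      obtain ⟨r, hr, hcheap⟩ := hf.exists_isCheapest i hi
      rw [abs_le] at hr
      exact ⟨r, by linarith, by linarith, hcheap⟩
    obtain ⟨hae, i, hi, hai⟩ :=
      exists_constant_used_of_unused hh hΛ (hf.feasible.2.trans hd.symm) hweights he.symm
    have hb : ((G.latency e).b : ℝ) = (G.latency i).b := by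
      simpa [AffineLatency.eval, hae, hai] using (hΛ e).trans (hΛ i).symm
    obtain ⟨r, hr, hcheap⟩ := hf.exists_isCheapest i hi
    refine ⟨r, hr, fun e' => le_trans (le_of_eq ?_) (hcheap e')⟩
    simp [weightedCost, hae, hai, hb]
  · exact hf.exists_isCheapest e he

theorem totalLatency_eq_of_equalized (hΛ : ∀ e, (G.latency e).eval (h e) = Λ) (f : G.Flow) :
    G.totalLatency f = Λ * ∑ e, f e
      + (∑ e, (G.latency e).a * (2 * f e - h e) ^ 2 - ∑ e, (G.latency e).a * h e ^ 2) / 4 := by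
  have complete_square (e : Fin G.n) : f e * (G.latency e).eval (f e)
      = Λ * f e + ((G.latency e).a * (2 * f e - h e) ^ 2 - (G.latency e).a * h e ^ 2) / 4 := by
    rw [← hΛ e, AffineLatency.eval, AffineLatency.eval]
    ring
  simp only [totalLatency, complete_square, Finset.sum_add_distrib, ← Finset.sum_div,
    Finset.sum_sub_distrib, ← Finset.mul_sum]

/-- In terms of `2 * f - h`, the total latency is a quadratic form whose minimum over all flows is
at equal marginal latencies; the equilibrium condition says that the marginal latencies at `f`
spread at most `E` times as much as those at `h`. -/
theorem IsDistortedEquilibrium.totalLatency_le (hf : G.IsDistortedEquilibrium E f) (hE0 : 0 ≤ E)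
    (hE : E < 1) (hh : ∀ e, 0 < h e) (hΛ : ∀ e, (G.latency e).eval (h e) = Λ)
    (hd : ∑ e, h e = G.demand) (hg : ∑ e, g e = G.demand) :
    G.totalLatency f ≤ (1 - E ^ 2) * G.totalLatency g + E ^ 2 * G.totalLatency h := by
  have hb (i : Fin G.n) : ((G.latency i).b : ℝ) = Λ - (G.latency i).a * h i := by
    rw [← hΛ i, AffineLatency.eval]
    ring
  have hspread (i j : Fin G.n) :
      (G.latency i).a * (2 * f i - h i) - (G.latency j).a * (2 * f j - h j)
        ≤ E * |(G.latency i).a * h i - (G.latency j).a * h j| := by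
    obtain ⟨r, hr, hcheap⟩ := hf.exists_isCheapest_of_equalized hE hh hΛ hd i
    have := hcheap.sub_le (j := j) hr
    rw [hb i, hb j, sub_sub_sub_cancel_left, abs_sub_comm] at this
    linarith
  have hform := sum_mul_sq_le_of_lipschitz (a := fun e => ((G.latency e).a : ℝ))
    (x := fun e => 2 * f e - h e) (y := fun e => 2 * g e - h e) (z := h)
    (fun _ => NNReal.coe_nonneg _) (pow_le_one₀ hE0 hE.le)
    (by simp only [Finset.sum_sub_distrib, ← Finset.mul_sum, hf.feasible.2, hg])
    (by simp only [Finset.sum_sub_distrib, ← Finset.mul_sum, hg, hd]; ring)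
    fun i j => abs_sub_le_iff.2 ⟨hspread i j, abs_sub_comm (_ * h i) _ ▸ hspread j i⟩
  have hh_form : ∑ e, ((G.latency e).a : ℝ) * (2 * h e - h e) ^ 2
      = ∑ e, (G.latency e).a * h e ^ 2 := by
    simp only [two_mul, add_sub_cancel_right]
  rw [totalLatency_eq_of_equalized hΛ f, totalLatency_eq_of_equalized hΛ g,
    totalLatency_eq_of_equalized hΛ h, hh_form, hf.feasible.2, hg, hd]
  linarith

theorem three_mul_totalLatency_le_of_equalized (hh : ∀ e, 0 ≤ h e)
    (hΛ : ∀ e, (G.latency e).eval (h e) = Λ) (hgh : ∑ e, g e = ∑ e, h e) :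
    3 * G.totalLatency h ≤ 4 * G.totalLatency g := by
  have variational : G.totalLatency h = ∑ e, g e * (G.latency e).eval (h e) := by
    simp only [totalLatency, hΛ, ← Finset.sum_mul, hgh]
  have smooth : ∑ e, g e * (G.latency e).eval (h e)
      ≤ ∑ e, (g e * (G.latency e).eval (g e) + 1 / 4 * (h e * (G.latency e).eval (h e))) := by
    refine Finset.sum_le_sum fun e _ => ?_
    unfold AffineLatency.eval
    -- `g h ≤ g ^ 2 + h ^ 2 / 4`
    linarith [mul_nonneg (G.latency e).a.coe_nonneg (sq_nonneg (g e - h e / 2)),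
      mul_nonneg (hh e) (G.latency e).b.coe_nonneg]
  rw [Finset.sum_add_distrib, ← Finset.mul_sum, ← variational] at smooth
  unfold totalLatency at *
  linarith

end Equilibrium

section Nash

variable {s : G.Users → ℝ} {T : Mechanism}

/-- Lebesgue measure on the interval of users. -/
noncomputable def userMeasure (G : ParallelGame) : Measure G.Users :=
  volume.comap Subtype.val

theorem userMeasure_real_apply (G : ParallelGame) (t : Set G.Users) :
    G.userMeasure.real t = volume.real (Subtype.val '' t) := by
  rw [measureReal_def, measureReal_def, userMeasure, comap_subtype_coe_apply measurableSet_Icc]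

theorem userMeasure_real_univ (G : ParallelGame) : G.userMeasure.real Set.univ = G.demand := by
  rw [userMeasure_real_apply, Subtype.coe_image_univ,
    Real.volume_real_Icc_of_le G.demand.coe_nonneg, sub_zero]

instance (G : ParallelGame) : IsFiniteMeasure G.userMeasure := by
  refine ⟨?_⟩
  rw [userMeasure, comap_subtype_coe_apply measurableSet_Icc, Subtype.coe_image_univ]
  exact measure_Icc_lt_top

theorem userMeasure_real_compl {S : Set G.Users} (hS : MeasurableSet S) :
    G.userMeasure.real Sᶜ = G.demand - G.userMeasure.real S := by
  rw [measureReal_compl hS, userMeasure_real_univ]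

theorem exists_measurableSet_userMeasure_real_eq (hd : 0 < G.demand) {t : ℝ}
    (ht : t ∈ Set.Icc 0 (G.demand : ℝ)) :
    ∃ S : Set G.Users, MeasurableSet S ∧ G.userMeasure.real S = t ∧
      (S.Nonempty → 0 < t) ∧ (Sᶜ.Nonempty → t < G.demand) := by
  rcases ht.2.eq_or_lt with rfl | hlt
  · exact ⟨Set.univ, .univ, G.userMeasure_real_univ, fun _ => NNReal.coe_pos.2 hd, by simp⟩
  · refine ⟨Subtype.val ⁻¹' Set.Iio t, measurable_subtype_coe measurableSet_Iio, ?_,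
      fun ⟨x, hx⟩ => x.2.1.trans_lt hx, fun _ => hlt⟩
    have hIco : Set.Icc 0 (G.demand : ℝ) ∩ Set.Iio t = Set.Ico 0 t := by
      ext x
      exact ⟨fun h => ⟨h.1.1, h.2⟩, fun h => ⟨⟨h.1, h.2.le.trans ht.2⟩, h.2⟩⟩
    rw [userMeasure_real_apply, Subtype.image_preimage_coe, hIco, Real.volume_real_Ico_of_le ht.1,
      sub_zero]

theorem isNash_iff : G.IsNash s T f ↔ ∃ P : G.Users → Fin G.n, Measurable P ∧
    (∀ e, f e = G.userMeasure.real (P ⁻¹' {e})) ∧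
    ∀ x e, G.cost T f (s x) (P x) ≤ G.cost T f (s x) e := by
  simp only [IsNash, userMeasure_real_apply, Set.preimage, Set.mem_singleton_iff]

theorem IsNash.mem_feasible (hf : G.IsNash s T f) : f ∈ G.feasible := by
  obtain ⟨P, hP, hfP, -⟩ := isNash_iff.1 hf
  refine ⟨fun e => (hfP e).symm ▸ measureReal_nonneg, ?_⟩
  simp only [hfP]
  rw [sum_measureReal_preimage_singleton _ fun e _ => hP (measurableSet_singleton e),
    Finset.coe_univ, Set.preimage_univ, userMeasure_real_univ]

theorem IsNash.exists_user (hf : G.IsNash s T f) {e : Fin G.n} (he : 0 < f e) :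
    ∃ x, ∀ e', G.cost T f (s x) e ≤ G.cost T f (s x) e' := by
  obtain ⟨P, -, hfP, hbest⟩ := isNash_iff.1 hf
  obtain ⟨x, rfl⟩ : (P ⁻¹' {e}).Nonempty :=
    nonempty_of_measureReal_ne_zero ((hfP e).symm.trans_ne he.ne')
  exact ⟨x, hbest x⟩

theorem FullyUtilized.exists_equalized (hG : G.FullyUtilized) :
    ∃ (h : G.Flow) (Λ : ℝ), (∀ e, 0 < h e) ∧ ∑ e, h e = G.demand ∧
      ∀ e, (G.latency e).eval (h e) = Λ := by
  obtain ⟨h, hh, hpos⟩ := hG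
  have eval_le (e e' : Fin G.n) : (G.latency e).eval (h e) ≤ (G.latency e').eval (h e') := by
    obtain ⟨_, hx⟩ := hh.exists_user (hpos e)
    simpa [cost] using hx e'
  rcases isEmpty_or_nonempty (Fin G.n) with _ | ⟨⟨e₀⟩⟩
  · exact ⟨h, 0, hpos, hh.mem_feasible.2, isEmptyElim⟩
  · exact ⟨h, _, hpos, hh.mem_feasible.2, fun e => le_antisymm (eval_le e e₀) (eval_le e₀ e)⟩

end Nash

end ParallelGame

section ConstantWeight

/-- The weight, relative to the flow-dependent part of a latency, that a user of sensitivity `σ`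
gives to its constant part under the mechanism `affineMechanism k₁ k₂`. Only meaningful if
`0 < 1 + σ * k₁`. -/
noncomputable def constantWeight (k₁ k₂ σ : ℝ) : ℝ :=
  (1 + σ * k₂) / (1 + σ * k₁)

variable {k k₁ k₂ k₂' σ σ' : ℝ}

theorem ParallelGame.cost_affineMechanism {G : ParallelGame} (hk : 0 < 1 + σ * k₁) (f : G.Flow)
    (e : Fin G.n) : G.cost (affineMechanism k₁ k₂) f σ e
      = (1 + σ * k₁) * G.weightedCost f (constantWeight k₁ k₂ σ) e := by
  simp only [cost, weightedCost, constantWeight, affineMechanism, AffineLatency.eval]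
  field_simp
  ring

theorem constantWeight_self (hk : 0 < 1 + σ * k) : constantWeight k k σ = 1 :=
  div_self hk.ne'

theorem constantWeight_le_constantWeight_iff (hσ : 0 < σ) (hk : 0 < 1 + σ * k₁) :
    constantWeight k₁ k₂ σ ≤ constantWeight k₁ k₂' σ ↔ k₂ ≤ k₂' := by
  rw [constantWeight, constantWeight, div_le_div_iff_of_pos_right hk, add_le_add_iff_left,
    mul_le_mul_iff_right₀ hσ]

theorem exists_constantWeight_eq (hσ : σ ≠ 0) (hk : 0 < 1 + σ * k₁) (r : ℝ) :
    ∃ k₂, constantWeight k₁ k₂ σ = r := by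
  refine ⟨(r * (1 + σ * k₁) - 1) / σ, ?_⟩
  rw [constantWeight, mul_div_cancel₀ _ hσ, add_sub_cancel, mul_div_cancel_right₀ _ hk.ne']

theorem constantWeight_le_of_le (hk : k₂ ≤ k₁) (hσ : 0 < 1 + σ * k₁) (hσ' : 0 < 1 + σ' * k₁)
    (hle : σ ≤ σ') : constantWeight k₁ k₂ σ' ≤ constantWeight k₁ k₂ σ := by
  rw [constantWeight, constantWeight, div_le_div_iff₀ hσ' hσ]
  linarith [mul_nonneg (sub_nonneg.2 hle) (sub_nonneg.2 hk)]

/-- The weights of two sensitivities cannot both be `1 / 2`. -/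
theorem constantWeight_spread (hσ : 0 < 1 + σ * k₁) (hσ' : 0 < 1 + σ' * k₁) :
    σ' * (1 + σ * k₁) * (2 * constantWeight k₁ k₂ σ - 1)
      - σ * (1 + σ' * k₁) * (2 * constantWeight k₁ k₂ σ' - 1) = σ' - σ := by
  unfold constantWeight
  field_simp
  ring

end ConstantWeight

/-- The price of anarchy of a mechanism under which the weights of constant latencies deviate from
`1 / 2` by at most `E / 2`, a bound that is attained. -/
noncomputable def poaOfDistortion (E : ℝ) : ℝ≥0∞ :=
  ENNReal.ofReal (1 + E ^ 2 / 3)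

theorem strictMonoOn_poaOfDistortion : StrictMonoOn poaOfDistortion (Set.Ici 0) := by
  intro E hE E' _ hlt
  rw [poaOfDistortion, poaOfDistortion, ENNReal.ofReal_lt_ofReal_iff (by positivity)]
  have := pow_lt_pow_left₀ hlt hE two_ne_zero
  linarith

section UpperBound

variable {SL SU k₁ k₂ E : ℝ}

theorem ParallelGame.IsNash.isDistortedEquilibrium {G : ParallelGame} {s : G.Users → ℝ}
    {f : G.Flow} (hf : G.IsNash s (affineMechanism k₁ k₂) f)
    (hk : ∀ x, 0 < 1 + s x * k₁ ∧ |2 * constantWeight k₁ k₂ (s x) - 1| ≤ E) :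
    G.IsDistortedEquilibrium E f := by
  refine ⟨hf.mem_feasible, fun e he => ?_⟩
  obtain ⟨x, hx⟩ := hf.exists_user he
  obtain ⟨hpos, hdist⟩ := hk x
  refine ⟨_, hdist, fun e' => le_of_mul_le_mul_left ?_ hpos⟩
  simpa only [cost_affineMechanism hpos] using hx e'

theorem ParallelGame.totalLatency_le_of_isNash {G : ParallelGame} (hG : G.FullyUtilized)
    {s : G.Users → ℝ} {f g : G.Flow} (hE0 : 0 ≤ E) (hE : E < 1)
    (hk : ∀ x, 0 < 1 + s x * k₁ ∧ |2 * constantWeight k₁ k₂ (s x) - 1| ≤ E)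
    (hf : G.IsNash s (affineMechanism k₁ k₂) f) (hg : g ∈ G.feasible) :
    G.totalLatency f ≤ (1 + E ^ 2 / 3) * G.totalLatency g := by
  obtain ⟨h, Λ, hh, hd, hΛ⟩ := hG.exists_equalized
  have hfh := (hf.isDistortedEquilibrium hk).totalLatency_le hE0 hE hh hΛ hd hg.2
  have hhg : 3 * G.totalLatency h ≤ 4 * G.totalLatency g :=
    three_mul_totalLatency_le_of_equalized (fun e => (hh e).le) hΛ (hg.2.trans hd.symm)
  linarith [mul_le_mul_of_nonneg_left hhg (sq_nonneg E)]

theorem priceOfAnarchy_affineMechanism_le (hE0 : 0 ≤ E) (hE : E < 1)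
    (hk : ∀ σ ∈ Set.Icc SL SU, 0 < 1 + σ * k₁ ∧ |2 * constantWeight k₁ k₂ σ - 1| ≤ E) :
    priceOfAnarchy SL SU (affineMechanism k₁ k₂) ≤ poaOfDistortion E := by
  refine iSup₂_le fun G hG => iSup₂_le fun s hs => ?_
  have hC : 0 < 1 + E ^ 2 / 3 := by positivity
  refine ENNReal.div_le_of_le_mul (iSup₂_le fun f hf => ?_)
  simp only [poaOfDistortion, ParallelGame.optLatency,
    ENNReal.mul_iInf_of_ne (ENNReal.ofReal_pos.2 hC).ne' ENNReal.ofReal_ne_top]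
  refine le_iInf₂ fun g hg => ?_
  rw [← ENNReal.ofReal_mul hC.le]
  exact ENNReal.ofReal_le_ofReal
    (ParallelGame.totalLatency_le_of_isNash hG hE0 hE (fun x => hk _ (hs x)) hf hg)

end UpperBound

section Pigou

/-- Pigou's network with latencies `f` and `1`. The mass of traffic is `1 + ε` and not `1`, so that
both edges are used in the untolled Nash flow. -/
abbrev pigouGame (ε : ℝ≥0) : ParallelGame where
  n := 2
  latency := ![⟨1, 0⟩, ⟨0, 1⟩]
  demand := 1 + ε

/-- The flow on Pigou's network that sends the mass `t` over the edge of latency `f`. -/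
def pigouFlow (ε : ℝ≥0) (t : ℝ) : (pigouGame ε).Flow :=
  ![t, 1 + ε - t]

variable {ε : ℝ≥0} {T : Mechanism} {SL SU k₁ k₂ t σ E : ℝ}

theorem coe_demand_pigouGame (ε : ℝ≥0) : ((pigouGame ε).demand : ℝ) = 1 + ε := by
  simp

theorem pigouFlow_mem_feasible (ht : t ∈ Set.Icc 0 (1 + ε : ℝ)) :
    pigouFlow ε t ∈ (pigouGame ε).feasible := by
  refine ⟨Fin.forall_fin_two.2 ⟨ht.1, sub_nonneg.2 ht.2⟩, (Fin.sum_univ_two _).trans ?_⟩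
  simp [pigouFlow]

theorem totalLatency_pigouFlow (ε : ℝ≥0) (t : ℝ) :
    (pigouGame ε).totalLatency (pigouFlow ε t) = 3 / 4 + (2 * t - 1) ^ 2 / 4 + ε := by
  refine (Fin.sum_univ_two _).trans ?_
  simp only [pigouFlow, AffineLatency.eval, Matrix.cons_val_zero, Matrix.cons_val_one,
    NNReal.coe_one, NNReal.coe_zero]
  ring

theorem cost_pigouFlow_zero (ε : ℝ≥0) (k₁ k₂ t σ : ℝ) :
    (pigouGame ε).cost (affineMechanism k₁ k₂) (pigouFlow ε t) σ 0 = (1 + σ * k₁) * t := by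
  simp only [ParallelGame.cost, affineMechanism, pigouFlow, AffineLatency.eval,
    Matrix.cons_val_zero, NNReal.coe_one, NNReal.coe_zero]
  ring

theorem cost_pigouFlow_one (ε : ℝ≥0) (k₁ k₂ t σ : ℝ) :
    (pigouGame ε).cost (affineMechanism k₁ k₂) (pigouFlow ε t) σ 1 = 1 + σ * k₂ := by
  simp only [ParallelGame.cost, affineMechanism, pigouFlow, AffineLatency.eval,
    Matrix.cons_val_one, Matrix.cons_val_fin_one, NNReal.coe_one, NNReal.coe_zero]
  ring

theorem isNash_pigouFlow (ht : t ∈ Set.Icc 0 (1 + ε : ℝ))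
    (h₀ : 0 < t → (pigouGame ε).cost T (pigouFlow ε t) σ 0
      ≤ (pigouGame ε).cost T (pigouFlow ε t) σ 1)
    (h₁ : t < 1 + ε → (pigouGame ε).cost T (pigouFlow ε t) σ 1
      ≤ (pigouGame ε).cost T (pigouFlow ε t) σ 0) :
    (pigouGame ε).IsNash (fun _ => σ) T (pigouFlow ε t) := by
  classical
  obtain ⟨S, hS, hSt, hSpos, hSlt⟩ :=
    ParallelGame.exists_measurableSet_userMeasure_real_eq (G := pigouGame ε) (by positivity)
      (coe_demand_pigouGame ε ▸ ht)
  rw [coe_demand_pigouGame] at hSlt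
  have hScompl : (pigouGame ε).userMeasure.real Sᶜ = 1 + ε - t := by
    rw [ParallelGame.userMeasure_real_compl hS, hSt, coe_demand_pigouGame]
  refine ParallelGame.isNash_iff.2 ⟨S.piecewise (fun _ => 0) fun _ => 1,
    measurable_const.piecewise hS measurable_const, Fin.forall_fin_two.2 ⟨?_, ?_⟩, fun x => ?_⟩
  · refine hSt.symm.trans (congrArg _ ?_)
    simp [Set.piecewise_preimage]
  · refine hScompl.symm.trans (congrArg _ ?_)
    simp [Set.piecewise_preimage, Set.compl_eq_univ_sdiff]
  · by_cases hx : x ∈ S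
    · rw [Set.piecewise_eq_of_mem _ _ _ hx]
      exact Fin.forall_fin_two.2 ⟨le_rfl, h₀ (hSpos ⟨x, hx⟩)⟩
    · rw [Set.piecewise_eq_of_notMem _ _ _ hx]
      exact Fin.forall_fin_two.2 ⟨h₁ (hSlt ⟨x, hx⟩), le_rfl⟩

theorem fullyUtilized_pigouGame (hε : 0 < ε) : (pigouGame ε).FullyUtilized := by
  refine ⟨pigouFlow ε 1, isNash_pigouFlow (by simp) (fun _ => ?_) (fun _ => ?_),
    Fin.forall_fin_two.2 ⟨one_pos, ?_⟩⟩
  · simp [ParallelGame.cost, pigouFlow, AffineLatency.eval]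
  · simp [ParallelGame.cost, pigouFlow, AffineLatency.eval]
  · simpa [pigouFlow] using hε

theorem optLatency_pigouGame_le (ε : ℝ≥0) :
    (pigouGame ε).optLatency ≤ ENNReal.ofReal (3 / 4 + ε) := by
  have hhalf : pigouFlow ε (1 / 2) ∈ (pigouGame ε).feasible :=
    pigouFlow_mem_feasible ⟨by norm_num, by linarith [ε.coe_nonneg]⟩
  refine (iInf₂_le _ hhalf).trans (ENNReal.ofReal_le_ofReal (le_of_eq ?_))
  rw [totalLatency_pigouFlow]
  ring

/-- The equilibria of the costs `A * t` and `B` on two edges that share the mass `d`. -/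
theorem exists_mem_Icc_equilibrium {A B d : ℝ} (hd : 1 ≤ d) (hE0 : 0 ≤ E) (hE1 : E ≤ 1)
    (hE : 0 < A → E ≤ |2 * (B / A) - 1|) :
    ∃ t ∈ Set.Icc 0 d, (0 < t → A * t ≤ B) ∧ (t < d → B ≤ A * t) ∧ E ^ 2 ≤ (2 * t - 1) ^ 2 := by
  have hd0 : 0 < d := one_pos.trans_le hd
  rcases le_or_gt B 0 with hB | hB
  · exact ⟨0, ⟨le_rfl, hd0.le⟩, fun h => h.false.elim, fun _ => by simpa using hB, by nlinarith⟩
  rcases le_or_gt (A * d) B with hAB | hAB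
  · exact ⟨d, ⟨hd0.le, le_rfl⟩, fun _ => hAB, fun h => h.false.elim, by nlinarith⟩
  have hA : 0 < A := pos_of_mul_pos_left (hB.trans hAB) hd0.le
  have heq : A * (B / A) = B := mul_div_cancel₀ _ hA.ne'
  refine ⟨B / A, ⟨by positivity, (div_le_iff₀' hA).2 hAB.le⟩, fun _ => heq.le, fun _ => heq.ge, ?_⟩
  exact sq_le_sq.2 ((abs_of_nonneg hE0).trans_le (hE hA))

theorem exists_isNash_pigouGame (hE0 : 0 ≤ E) (hE1 : E ≤ 1)
    (h : 0 < 1 + σ * k₁ → E ≤ |2 * constantWeight k₁ k₂ σ - 1|) :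
    ∃ f, (pigouGame ε).IsNash (fun _ => σ) (affineMechanism k₁ k₂) f ∧
      3 / 4 + E ^ 2 / 4 + ε ≤ (pigouGame ε).totalLatency f := by
  obtain ⟨t, ht, h₀, h₁, hEt⟩ :=
    exists_mem_Icc_equilibrium (d := 1 + ε) (by simp) hE0 hE1 h
  refine ⟨pigouFlow ε t, isNash_pigouFlow ht ?_ ?_, ?_⟩
  · rwa [cost_pigouFlow_zero, cost_pigouFlow_one]
  · rwa [cost_pigouFlow_zero, cost_pigouFlow_one]
  · rw [totalLatency_pigouFlow]
    linarith

theorem le_priceOfAnarchy_of_pigouGame (hσ : σ ∈ Set.Icc SL SU) (hε : 0 < ε)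
    {f : (pigouGame ε).Flow} (hf : (pigouGame ε).IsNash (fun _ => σ) T f) :
    ENNReal.ofReal ((pigouGame ε).totalLatency f / (3 / 4 + ε)) ≤ priceOfAnarchy SL SU T := by
  have hopt : (0 : ℝ) < 3 / 4 + ε := by positivity
  calc
    _ ≤ (pigouGame ε).nashLatency (fun _ => σ) T / (pigouGame ε).optLatency := by
      rw [ENNReal.ofReal_div_of_pos hopt]
      exact ENNReal.div_le_div (le_iSup₂_of_le f hf le_rfl) (optLatency_pigouGame_le ε)
    _ ≤ priceOfAnarchy SL SU T :=
      le_iSup₂_of_le (pigouGame ε) (fullyUtilized_pigouGame hε) <|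
        le_iSup₂_of_le (fun _ => σ) (fun _ => hσ) le_rfl

theorem le_priceOfAnarchy_affineMechanism (hσ : σ ∈ Set.Icc SL SU) (hE0 : 0 ≤ E) (hE1 : E ≤ 1)
    (h : 0 < 1 + σ * k₁ → E ≤ |2 * constantWeight k₁ k₂ σ - 1|) :
    poaOfDistortion E ≤ priceOfAnarchy SL SU (affineMechanism k₁ k₂) := by
  have hbound (ε : ℝ) (hε : 0 < ε) : ENNReal.ofReal ((3 / 4 + E ^ 2 / 4 + ε) / (3 / 4 + ε))
      ≤ priceOfAnarchy SL SU (affineMechanism k₁ k₂) := by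
    lift ε to ℝ≥0 using hε.le
    obtain ⟨f, hf, hfL⟩ := exists_isNash_pigouGame (ε := ε) hE0 hE1 h
    exact le_trans (by gcongr) (le_priceOfAnarchy_of_pigouGame hσ (mod_cast hε) hf)
  have hcont : ContinuousAt (fun ε : ℝ => (3 / 4 + E ^ 2 / 4 + ε) / (3 / 4 + ε)) 0 :=
    ContinuousAt.div (by fun_prop) (by fun_prop) (by norm_num)
  have hlim := ENNReal.tendsto_ofReal
    (hcont.tendsto.mono_left (nhdsWithin_le_nhds (s := Set.Ioi 0)))
  have hvalue : (3 / 4 + E ^ 2 / 4 + 0) / (3 / 4 + 0) = 1 + E ^ 2 / 3 := by ring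
  rw [hvalue] at hlim
  exact le_of_tendsto hlim (eventually_nhdsWithin_of_forall hbound)

end Pigou

section AffineBox

variable {SL SU lo hi β k₁ k₂ : ℝ} {T : Mechanism} {c : ℝ≥0∞}

/-- The affine mechanisms whose two coefficients lie between `lo` and `hi`. Tolls and subsidies with
bound `β` are the cases `[0, β]` and `[-β, 0]`. -/
def affineBox (lo hi : ℝ) : Set Mechanism :=
  Set.image2 affineMechanism (Set.Icc lo hi) (Set.Icc lo hi)

theorem forall_affineMechanism_mem_Icc_iff :
    (∀ (l : AffineLatency) (f : ℝ), 0 ≤ f →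
      affineMechanism k₁ k₂ l f ∈ Set.Icc (lo * l.eval f) (hi * l.eval f)) ↔
      k₁ ∈ Set.Icc lo hi ∧ k₂ ∈ Set.Icc lo hi := by
  constructor
  · intro h
    have h₁ := h ⟨1, 0⟩ 1 zero_le_one
    have h₂ := h ⟨0, 1⟩ 0 le_rfl
    simp only [affineMechanism, AffineLatency.eval, NNReal.coe_one, NNReal.coe_zero, mul_one,
      mul_zero, add_zero, zero_add] at h₁ h₂
    exact ⟨h₁, h₂⟩
  · rintro ⟨h₁, h₂⟩ l f hf
    simp only [affineMechanism, AffineLatency.eval, mul_add]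
    exact ⟨by gcongr; exacts [h₁.1, h₂.1], by gcongr; exacts [h₁.2, h₂.2]⟩

theorem mem_affineBox_iff : T ∈ affineBox lo hi ↔ (∃ k₁ k₂, T = affineMechanism k₁ k₂) ∧
    ∀ (l : AffineLatency) (f : ℝ), 0 ≤ f → T l f ∈ Set.Icc (lo * l.eval f) (hi * l.eval f) := by
  constructor
  · rintro ⟨k₁, h₁, k₂, h₂, rfl⟩
    exact ⟨⟨k₁, k₂, rfl⟩, forall_affineMechanism_mem_Icc_iff.2 ⟨h₁, h₂⟩⟩
  · rintro ⟨⟨k₁, k₂, rfl⟩, hT⟩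
    obtain ⟨h₁, h₂⟩ := forall_affineMechanism_mem_Icc_iff.1 hT
    exact ⟨k₁, h₁, k₂, h₂, rfl⟩

theorem affineTolls_eq_affineBox : affineTolls β = affineBox 0 β := by
  ext T
  simp only [affineTolls, mem_affineBox_iff, zero_mul, Set.mem_ofPred_eq]

theorem affineSubsidies_eq_affineBox : affineSubsidies β = affineBox (-β) 0 := by
  ext T
  simp only [affineSubsidies, mem_affineBox_iff, zero_mul, neg_mul, Set.mem_ofPred_eq]

theorem exists_isOptimalMechanism {M : Set Mechanism}
    (h : IsLeast (priceOfAnarchy SL SU '' M) c) : ∃ T, IsOptimalMechanism SL SU M T := by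
  obtain ⟨⟨T, hT, rfl⟩, hmin⟩ := h
  exact ⟨T, hT, fun T' hT' => hmin ⟨T', hT', rfl⟩⟩

theorem IsOptimalMechanism.priceOfAnarchy_eq {M : Set Mechanism}
    (hT : IsOptimalMechanism SL SU M T) (h : IsLeast (priceOfAnarchy SL SU '' M) c) :
    priceOfAnarchy SL SU T = c :=
  IsLeast.unique ⟨Set.mem_image_of_mem _ hT.1, Set.forall_mem_image.2 hT.2⟩ h

end AffineBox

section OptimalDistortion

variable {SL SU lo hi k k₁ k₂ E σ σ' : ℝ}

/-- The smallest distortion `E` for which the mechanisms `affineMechanism k k₂` can bring the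
weights of the sensitivities `SL` and `SU` to `(1 + E) / 2` and `(1 - E) / 2`. -/
noncomputable def sensitivitySpread (SL SU k : ℝ) : ℝ :=
  (SU - SL) / (SU * (1 + SL * k) + SL * (1 + SU * k))

/-- The smallest distortion that a mechanism of `affineBox lo hi` can guarantee for all
sensitivities in `[SL, SU]`. The first term is the distortion of the least weight that can be given
to the sensitivity `SL`. -/
noncomputable def optimalDistortion (SL SU lo hi : ℝ) : ℝ :=
  max (2 * constantWeight hi lo SL - 1) (sensitivitySpread SL SU hi)

theorem constantWeight_le_constantWeight (hσ : 0 ≤ σ) (hk₁ : 0 < 1 + σ * k₁) (hlo : 0 ≤ 1 + σ * lo)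
    (h₁ : k₁ ≤ hi) (h₂ : lo ≤ k₂) : constantWeight hi lo σ ≤ constantWeight k₁ k₂ σ := by
  have hle : 1 + σ * lo ≤ 1 + σ * k₂ := by gcongr
  exact div_le_div₀ (hlo.trans hle) hle hk₁ (by gcongr)

theorem sensitivitySpread_le_max (hσ : 0 < σ) (hσ' : 0 < σ') (hk : 0 < 1 + σ * k₁)
    (hk' : 0 < 1 + σ' * k₁) : sensitivitySpread σ σ' k₁ ≤
      max |2 * constantWeight k₁ k₂ σ - 1| |2 * constantWeight k₁ k₂ σ' - 1| := by
  set x := 2 * constantWeight k₁ k₂ σ - 1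
  set y := 2 * constantWeight k₁ k₂ σ' - 1
  rw [sensitivitySpread, div_le_iff₀' (by positivity)]
  calc
    σ' - σ = σ' * (1 + σ * k₁) * x + σ * (1 + σ' * k₁) * -y := by
      rw [← constantWeight_spread hk hk' (k₂ := k₂)]
      ring
    _ ≤ σ' * (1 + σ * k₁) * max |x| |y| + σ * (1 + σ' * k₁) * max |x| |y| := by
      gcongr
      · exact (le_abs_self x).trans (le_max_left _ _)
      · exact (neg_le_abs y).trans (le_max_right _ _)
    _ = (σ' * (1 + σ * k₁) + σ * (1 + σ' * k₁)) * max |x| |y| := by ring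

theorem sensitivitySpread_le_of_le (hSL : 0 < SL) (hle : SL ≤ SU) (hk : 0 < 1 + SL * k₁)
    (hk' : 0 < 1 + SU * k₁) (h : k₁ ≤ k₂) :
    sensitivitySpread SL SU k₂ ≤ sensitivitySpread SL SU k₁ := by
  have hSU := hSL.trans_le hle
  exact div_le_div_of_nonneg_left (sub_nonneg.2 hle) (by positivity) (by gcongr)

theorem sensitivitySpread_nonneg (hSL : 0 < SL) (hle : SL ≤ SU) (hk : 0 ≤ k) :
    0 ≤ sensitivitySpread SL SU k := by
  have hSU := hSL.trans_le hle
  exact div_nonneg (sub_nonneg.2 hle) (by positivity)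

theorem optimalDistortion_nonneg (hSL : 0 < SL) (hle : SL ≤ SU) (hhi : 0 ≤ hi) :
    0 ≤ optimalDistortion SL SU lo hi :=
  (sensitivitySpread_nonneg hSL hle hhi).trans (le_max_right _ _)

theorem optimalDistortion_lt_one (hSL : 0 < SL) (hle : SL ≤ SU) (hhi : 0 ≤ hi) (hlohi : lo < hi) :
    optimalDistortion SL SU lo hi < 1 := by
  have hSU := hSL.trans_le hle
  have hk : 0 < 1 + SL * hi := by positivity
  refine max_lt ?_ ?_
  · have : constantWeight hi lo SL < 1 := by
      rw [← constantWeight_self hk]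
      exact lt_of_not_ge fun h => hlohi.not_ge ((constantWeight_le_constantWeight_iff hSL hk).1 h)
    linarith
  · rw [sensitivitySpread, div_lt_one (by positivity)]
    linarith [mul_nonneg (mul_nonneg hSL.le hSU.le) hhi]

theorem poaOfDistortion_optimalDistortion_le (hSL : 0 < SL) (hle : SL ≤ SU) (hhi : 0 ≤ hi)
    (hlohi : lo < hi) (h₁ : k₁ ≤ hi) (h₂ : lo ≤ k₂) :
    poaOfDistortion (optimalDistortion SL SU lo hi)
      ≤ priceOfAnarchy SL SU (affineMechanism k₁ k₂) := by
  have hSU := hSL.trans_le hle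
  have hE0 := optimalDistortion_nonneg (lo := lo) hSL hle hhi
  have hE1 := (optimalDistortion_lt_one hSL hle hhi hlohi).le
  rcases max_choice (2 * constantWeight hi lo SL - 1) (sensitivitySpread SL SU hi) with hE | hE
  · refine le_priceOfAnarchy_affineMechanism ⟨le_rfl, hle⟩ hE0 hE1 fun hk => ?_
    rw [optimalDistortion, hE] at hE0 ⊢
    have hlo : 0 < 1 + SL * lo := by
      have hpos : 0 < constantWeight hi lo SL := by linarith
      exact (div_pos_iff_of_pos_right (by positivity)).1 hpos
    refine le_trans ?_ (le_abs_self _)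
    gcongr
    exact constantWeight_le_constantWeight hSL.le hk hlo.le h₁ h₂
  · change optimalDistortion SL SU lo hi = _ at hE
    by_contra hlt
    have small {σ : ℝ} (hσ : σ ∈ Set.Icc SL SU) : 0 < 1 + σ * k₁ ∧
        |2 * constantWeight k₁ k₂ σ - 1| < sensitivitySpread SL SU hi := by
      simpa only [← hE, Classical.not_imp, not_le] using
        mt (le_priceOfAnarchy_affineMechanism hσ hE0 hE1) hlt
    obtain ⟨hk, hL⟩ := small ⟨le_rfl, hle⟩
    obtain ⟨hk', hU⟩ := small ⟨hle, le_rfl⟩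
    exact (max_lt hL hU).not_ge ((sensitivitySpread_le_of_le hSL hle hk hk' h₁).trans
      (sensitivitySpread_le_max hSL hSU hk hk'))

/-- Once the weight of the sensitivity `SL` is `(1 + E) / 2`, the weight of `SU` is at least
`(1 - E) / 2`, and the other weights lie in between. -/
theorem abs_two_mul_constantWeight_sub_one_le (hSL : 0 < SL) (hhi : 0 ≤ hi) (hk₂ : k₂ ≤ hi)
    (hL : constantWeight hi k₂ SL = (1 + E) / 2) (hE : sensitivitySpread SL SU hi ≤ E)
    (hσ : σ ∈ Set.Icc SL SU) : |2 * constantWeight hi k₂ σ - 1| ≤ E := by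
  have hσ0 := hSL.trans_le hσ.1
  have hSU := hσ0.trans_le hσ.2
  have hkL : 0 < 1 + SL * hi := by positivity
  have hkU : 0 < 1 + SU * hi := by positivity
  have hkσ : 0 < 1 + σ * hi := by positivity
  have hleL := constantWeight_le_of_le hk₂ hkL hkσ hσ.1
  have hUle := constantWeight_le_of_le hk₂ hkσ hkU hσ.2
  have hU : -E ≤ 2 * constantWeight hi k₂ SU - 1 := by
    rw [sensitivitySpread, div_le_iff₀ (by positivity),
      ← constantWeight_spread hkL hkU (k₂ := k₂), hL] at hE
    have hcoeff : 0 < SL * (1 + SU * hi) := by positivity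
    refine le_of_mul_le_mul_left ?_ hcoeff
    linarith
  exact abs_le.2 ⟨by linarith, by linarith⟩

theorem exists_affineMechanism_priceOfAnarchy_le (hSL : 0 < SL) (hle : SL ≤ SU) (hhi : 0 ≤ hi)
    (hlohi : lo < hi) :
    ∃ k₂ ∈ Set.Icc lo hi, priceOfAnarchy SL SU (affineMechanism hi k₂)
      ≤ poaOfDistortion (optimalDistortion SL SU lo hi) := by
  set E := optimalDistortion SL SU lo hi
  have hE0 : 0 ≤ E := optimalDistortion_nonneg hSL hle hhi
  have hE1 : E < 1 := optimalDistortion_lt_one hSL hle hhi hlohi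
  have hk : 0 < 1 + SL * hi := by positivity
  obtain ⟨k₂, hk₂⟩ := exists_constantWeight_eq hSL.ne' hk ((1 + E) / 2)
  have hlo : lo ≤ k₂ := by
    rw [← constantWeight_le_constantWeight_iff hSL hk, hk₂]
    have : 2 * constantWeight hi lo SL - 1 ≤ E := le_max_left _ _
    linarith
  have hhi' : k₂ ≤ hi := by
    rw [← constantWeight_le_constantWeight_iff hSL hk, hk₂, constantWeight_self hk]
    linarith
  refine ⟨k₂, ⟨hlo, hhi'⟩, priceOfAnarchy_affineMechanism_le hE0 hE1 fun σ hσ => ⟨?_, ?_⟩⟩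
  · have := hSL.trans_le hσ.1
    positivity
  · exact abs_two_mul_constantWeight_sub_one_le hSL hhi hhi' hk₂ (le_max_right _ _) hσ

theorem isLeast_priceOfAnarchy_affineBox (hSL : 0 < SL) (hle : SL ≤ SU) (hhi : 0 ≤ hi)
    (hlohi : lo < hi) : IsLeast (priceOfAnarchy SL SU '' affineBox lo hi)
      (poaOfDistortion (optimalDistortion SL SU lo hi)) := by
  have hlower : poaOfDistortion (optimalDistortion SL SU lo hi)
      ∈ lowerBounds (priceOfAnarchy SL SU '' affineBox lo hi) := by
    rintro _ ⟨_, ⟨k₁, h₁, k₂, h₂, rfl⟩, rfl⟩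
    exact poaOfDistortion_optimalDistortion_le hSL hle hhi hlohi h₁.2 h₂.1
  obtain ⟨k₂, hk₂, hupper⟩ := exists_affineMechanism_priceOfAnarchy_le hSL hle hhi hlohi
  have hmem : affineMechanism hi k₂ ∈ affineBox lo hi := ⟨hi, ⟨hlohi.le, le_rfl⟩, k₂, hk₂, rfl⟩
  exact ⟨⟨_, hmem, hupper.antisymm (hlower ⟨_, hmem, rfl⟩)⟩, hlower⟩

end OptimalDistortion

section Comparison

variable {SL SU k k' β σ : ℝ}

theorem constantWeight_zero_right_lt (hσ : 0 < σ) (hk : 0 < 1 + σ * k) (h : k < k') :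
    constantWeight k' 0 σ < constantWeight k 0 σ := by
  rw [constantWeight, constantWeight, mul_zero, add_zero]
  exact one_div_lt_one_div_of_lt hk (by gcongr)

theorem constantWeight_zero_neg_lt (hσ : 0 < σ) (hβ : 0 < β) :
    constantWeight 0 (-β) σ < constantWeight β 0 σ := by
  have hx : 0 < σ * β := mul_pos hσ hβ
  simp only [constantWeight, mul_zero, add_zero, div_one]
  rw [lt_div_iff₀ (by positivity)]
  linarith [mul_pos hx hx]

theorem two_mul_constantWeight_inv_zero_sub_one (hSL : 0 < SL) (hle : SL ≤ SU) :
    2 * constantWeight SU⁻¹ 0 SL - 1 = sensitivitySpread SL SU 0 := by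
  have hSU := hSL.trans_le hle
  rw [sensitivitySpread, constantWeight]
  field_simp
  ring

theorem sensitivitySpread_lt_sensitivitySpread_zero (hSL : 0 < SL) (hlt : SL < SU) (hβ : 0 < β) :
    sensitivitySpread SL SU β < sensitivitySpread SL SU 0 := by
  have hSU := hSL.trans hlt
  exact div_lt_div_of_pos_left (sub_pos.2 hlt) (by simp only [mul_zero]; positivity) (by gcongr)

theorem two_mul_constantWeight_zero_sub_one_lt (hSL : 0 < SL) (hle : SL ≤ SU) (hβ : SU⁻¹ < β) :
    2 * constantWeight β 0 SL - 1 < sensitivitySpread SL SU 0 := by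
  have hSU := hSL.trans_le hle
  rw [← two_mul_constantWeight_inv_zero_sub_one hSL hle]
  gcongr
  exact constantWeight_zero_right_lt hSL (by positivity) hβ

theorem optimalDistortion_tolls_le (hSL : 0 < SL) (hle : SL ≤ SU) (hβ : SU⁻¹ < β) :
    optimalDistortion SL SU 0 β ≤ sensitivitySpread SL SU 0 :=
  have hβ0 : 0 < β := (inv_pos.2 (hSL.trans_le hle)).trans hβ
  max_le (two_mul_constantWeight_zero_sub_one_lt hSL hle hβ).le
    (sensitivitySpread_le_of_le hSL hle (by simp) (by simp) hβ0.le)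

theorem optimalDistortion_tolls_lt (hSL : 0 < SL) (hlt : SL < SU) (hβ : SU⁻¹ < β) :
    optimalDistortion SL SU 0 β < sensitivitySpread SL SU 0 :=
  have hβ0 : 0 < β := (inv_pos.2 (hSL.trans hlt)).trans hβ
  max_lt (two_mul_constantWeight_zero_sub_one_lt hSL hlt.le hβ)
    (sensitivitySpread_lt_sensitivitySpread_zero hSL hlt hβ0)

theorem optimalDistortion_subsidies_lt_tolls (hSL : 0 < SL) (hle : SL ≤ SU) (hβ : 0 < β)
    (hβSU : β < SU⁻¹) : optimalDistortion SL SU (-β) 0 < optimalDistortion SL SU 0 β := by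
  refine lt_max_of_lt_left (max_lt ?_ ?_)
  · gcongr
    exact constantWeight_zero_neg_lt hSL hβ
  · rw [← two_mul_constantWeight_inv_zero_sub_one hSL hle]
    gcongr
    exact constantWeight_zero_right_lt hSL (by positivity) hβSU

theorem optimalDistortion_subsidies_inv_eq_tolls (hSL : 0 < SL) (hle : SL ≤ SU) :
    optimalDistortion SL SU (-SU⁻¹) 0 = optimalDistortion SL SU 0 SU⁻¹ := by
  have hβ : 0 < SU⁻¹ := inv_pos.2 (hSL.trans_le hle)
  have htoll := two_mul_constantWeight_inv_zero_sub_one hSL hle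
  have hspread : sensitivitySpread SL SU SU⁻¹ ≤ sensitivitySpread SL SU 0 :=
    sensitivitySpread_le_of_le hSL hle (by simp) (by simp) hβ.le
  have hsubsidy : 2 * constantWeight 0 (-SU⁻¹) SL - 1 ≤ sensitivitySpread SL SU 0 := by
    rw [← htoll]
    gcongr
    exact (constantWeight_zero_neg_lt hSL hβ).le
  rw [optimalDistortion, optimalDistortion, htoll, max_eq_right hsubsidy, max_eq_left hspread]

end Comparison

theorem theorem5_general (SL SU : ℝ) (hSL : 0 < SL) (hle : SL ≤ SU) (β : ℝ) (hβ : 0 < β) :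
    (∃ Tp, IsOptimalMechanism SL SU (affineTolls β) Tp) ∧
    (∃ Tm, IsOptimalMechanism SL SU (affineSubsidies β) Tm) ∧
    ∀ Tp Tm : Mechanism,
      IsOptimalMechanism SL SU (affineTolls β) Tp →
      IsOptimalMechanism SL SU (affineSubsidies β) Tm →
        (β = 1 / SU → priceOfAnarchy SL SU Tm = priceOfAnarchy SL SU Tp) ∧
        (β < 1 / SU → priceOfAnarchy SL SU Tm < priceOfAnarchy SL SU Tp) ∧
        (1 / SU < β → priceOfAnarchy SL SU Tp ≤ priceOfAnarchy SL SU Tm) ∧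
        (1 / SU < β → SL < SU → priceOfAnarchy SL SU Tp < priceOfAnarchy SL SU Tm) := by
  rw [affineTolls_eq_affineBox, affineSubsidies_eq_affineBox, one_div]
  have htolls := isLeast_priceOfAnarchy_affineBox hSL hle hβ.le hβ
  have hsubsidies := isLeast_priceOfAnarchy_affineBox hSL hle le_rfl (neg_lt_zero.2 hβ)
  have htolls_nonneg : 0 ≤ optimalDistortion SL SU 0 β := optimalDistortion_nonneg hSL hle hβ.le
  have hsubsidies_nonneg : 0 ≤ optimalDistortion SL SU (-β) 0 :=
    optimalDistortion_nonneg hSL hle le_rfl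
  refine ⟨exists_isOptimalMechanism htolls, exists_isOptimalMechanism hsubsidies,
    fun Tp Tm hTp hTm => ?_⟩
  rw [hTp.priceOfAnarchy_eq htolls, hTm.priceOfAnarchy_eq hsubsidies,
    strictMonoOn_poaOfDistortion.lt_iff_lt hsubsidies_nonneg htolls_nonneg,
    strictMonoOn_poaOfDistortion.lt_iff_lt htolls_nonneg hsubsidies_nonneg,
    strictMonoOn_poaOfDistortion.le_iff_le htolls_nonneg hsubsidies_nonneg]
  exact ⟨by rintro rfl; rw [optimalDistortion_subsidies_inv_eq_tolls hSL hle],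
    optimalDistortion_subsidies_lt_tolls hSL hle hβ,
    fun h => (optimalDistortion_tolls_le hSL hle h).trans (le_max_right _ _),
    fun h hlt => (optimalDistortion_tolls_lt hSL hlt h).trans_le (le_max_right _ _)⟩

theorem theorem5 (SL SU : ℝ) (hSL : 0 < SL) (hle : SL ≤ SU) (hnorm : SL * SU = 1) :
    1 / SU = SL ∧
    ∀ β : ℝ, 0 < β →
      (∃ Tp, IsOptimalMechanism SL SU (affineTolls β) Tp) ∧
      (∃ Tm, IsOptimalMechanism SL SU (affineSubsidies β) Tm) ∧
      ∀ Tp Tm : Mechanism,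
        IsOptimalMechanism SL SU (affineTolls β) Tp →
        IsOptimalMechanism SL SU (affineSubsidies β) Tm →
          (β = 1 / SU → priceOfAnarchy SL SU Tm = priceOfAnarchy SL SU Tp) ∧
          (β < 1 / SU → priceOfAnarchy SL SU Tm < priceOfAnarchy SL SU Tp) ∧
          (1 / SU < β → priceOfAnarchy SL SU Tp ≤ priceOfAnarchy SL SU Tm) ∧
          (1 / SU < β → SL < SU → priceOfAnarchy SL SU Tp < priceOfAnarchy SL SU Tm) :=
  ⟨(eq_one_div_of_mul_eq_one_left hnorm).symm, theorem5_general SL SU hSL hle⟩
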